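/- Let $\mathbb F_q$ be a finite field with $q$ elements, where $q\equiv 3\pmod 4$, and let $n$ be a positive integer such that $8\mid n$ and $\operatorname{rad}(n)\mid q-1$, where $\operatorname{rad}(n)$ is the product of the distinct primes dividing $n$. Let $\theta$ be a generator of $\mathbb F_q^*$, and let $\alpha$ be a generator of $\mathbb F_{q^2}^*$ with $\alpha^{q+1}=\theta$. Write $\nu_p(k)$ for the exponent of the prime $p$ in $k$, $\varphi$ for Euler's totient function, and $\{a\}_b$ for the remainder of $a$ on division by $b$. Put $$m=\frac{n}{\gcd(n,q^2-1)},\quad l_1=\frac{q-1}{\gcd(q-1,n)},\quad l_2=\frac{q^2-1}{\gcd(q^2-1,n)},\quad r=\min\{\nu_2(n/2),\nu_2(q+1)\}.$$ (a) The factorization of $x^n-1$ into irreducible factors of $\mathbb F_q[x]$ is $$x^n-1=\prod_{\substack{t\mid m\\ t\text{ odd}}}\ \prod_{\substack{1\le w\le \gcd(n,q-1)\\ \gcd(w,t)=1}}\left(x^t-\theta^{wl_1}\right)\cdot\prod_{t\mid m}\ \prod_{u\in\mathcal R_t}\left(x^{2t}-(\alpha^{ul_2}+\alpha^{qul_2})x^t+\theta^{ul_2}\right),$$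 where $$\mathcal R_t=\left\{u\in\mathbb N : 1\le u\le\gcd(n,q^2-1),\ \gcd(u,t)=1,\ 2^r\nmid u,\ u<\{qu\}_{\gcd(n,q^2-1)}\right\}.$$ That is, every $\alpha^{ul_2}+\alpha^{qul_2}$ lies in $\mathbb F_q$, the identity holds in $\mathbb F_q[x]$, and every factor displayed is irreducible over $\mathbb F_q$. (b) Call a polynomial a binomial (respectively a trinomial) if it has exactly two (respectively three) nonzero terms, and count monic irreducible factors of $x^n-1$ in $\mathbb F_q[x]$. For each odd $t\mid m$, the number of irreducible binomials of degree $t$ is $\frac{\varphi(t)}{t}\gcd(n,q-1)$, and the number of irreducible binomials of degree $2t$ is $\frac{\varphi(t)}{2t}\gcd(n,q-1)$. For each $t\mid m$, the number of irreducible trinomials of degree $2t$ is $$\begin{cases}\dfrac{\varphi(t)}{t}\,2^{r-1}\gcd(n,q-1)&\text{if } t\text{ is even},\\[2mm] \dfrac{\varphi(t)}{t}\,(2^{r-1}-1)\gcd(n,q-1)&\text{if } t\text{ is odd}.\end{cases}$$ The total number of irreducible factors is $$\gcd(n,q-1)\cdot\left(\frac12+2^{r-2}\,(2+\nu_2(m))\right)\cdot\prod_{\substack{p\mid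 m\\ p\text{ odd prime}}}\left(1+\nu_p(m)\,\frac{p-1}{p}\right).$$ -/

import Mathlib

open Polynomial

/-- The monic irreducible factors of `f`. -/
def monicIrreducibleFactors {F : Type*} [Field F] (f : F[X]) : Set F[X] :=
  {g | g.Monic ∧ Irreducible g ∧ g ∣ f}

/-- A binomial is a polynomial with exactly two nonzero terms. -/
def IsBinomial {F : Type*} [Field F] (f : F[X]) : Prop := f.support.card = 2

/-- A trinomial is a polynomial with exactly three nonzero terms. -/
def IsTrinomial {F : Type*} [Field F] (f : F[X]) : Prop := f.support.card = 3

/-- The set `R_t` of all `u` with `1 ≤ u ≤ gcd(n, q² - 1)`, `gcd(u, t) = 1`, `2 ^ r ∤ u` and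
`u < {q u}_{gcd(n, q² - 1)}`, the remainder of `q u` modulo `gcd(n, q² - 1)`. -/
def trinomialIndices (q n r t : ℕ) : Finset ℕ :=
  (Finset.Icc 1 (Nat.gcd n (q ^ 2 - 1))).filter fun u =>
    Nat.gcd u t = 1 ∧ ¬ 2 ^ r ∣ u ∧ u < (q * u) % Nat.gcd n (q ^ 2 - 1)

/-- The set of all `w` with `1 ≤ w ≤ gcd(n, q - 1)` and `gcd(w, t) = 1`. -/
def binomialIndices (q n t : ℕ) : Finset ℕ :=
  (Finset.Icc 1 (Nat.gcd n (q - 1))).filter fun w => Nat.gcd w t = 1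

/-! Each displayed polynomial is monic, irreducible and divides `X ^ n - 1`, and no two coincide. It
therefore suffices that their degrees add up to `n`: unique factorization then gives the product
formula and shows that there are no further factors. All counts become counts of indices.

Irreducibility: for odd `t`, `X ^ t - a` is irreducible once `a` is not a `p`-th power for any prime
`p ∣ t`. With `β = α ^ (u * l₂)`, the trinomial is `(X ^ t - β) * (X ^ t - β ^ q)` over `E`. Both
factors are irreducible over `E` (where `-1` is a square, so `4 ∣ t` does no harm), coprime, and
swapped by Frobenius; hence the product is irreducible over `F`.

Counting: put `g = gcd(n, q - 1)` and `d = gcd(n, q ^ 2 - 1) = 2 ^ r * g`. Since `q ^ 2 ≡ 1` modulo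
`d`, `u ↦ q * u % d` is an involution, and its fixed points are the multiples of `2 ^ r`. So `R_t`
holds one index from each orbit of size two, and its size is half a count of residues coprime to
`t`. For each `t ∣ m` the degrees contribute `φ(t) * d`, and `∑ φ(t) = m` gives `m * d = n`. The
middle coefficient `β + β ^ q` vanishes exactly when `2 ^ (r - 1) ∣ u`, which separates binomials of
degree `2t` from trinomials. -/

/-! ### Counting coprime residues in an interval -/

theorem Nat.count_mul_of_periodic {p : ℕ → Prop} [DecidablePred p] {N : ℕ}
    (hp : Function.Periodic p N) (k : ℕ) : Nat.count p (N * k) = k * Nat.count p N := by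
  induction k with
  | zero => simp
  | succ k ih =>
    rw [Nat.mul_succ, Nat.count_add, ih]
    have : (fun j => p (N * k + j)) = p := by
      ext j
      have := hp.nat_mul k j
      rw [add_comm, mul_comm]
      simpa using this
    simp only [this]
    ring

theorem Nat.gcd_eq_one_congr_of_primes {t a b : ℕ}
    (h : ∀ p : ℕ, p.Prime → p ∣ t → (p ∣ a ↔ p ∣ b)) : Nat.gcd a t = 1 ↔ Nat.gcd b t = 1 := by
  have key : ∀ {a b : ℕ}, (∀ p : ℕ, p.Prime → p ∣ t → (p ∣ a ↔ p ∣ b)) →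
      Nat.gcd a t = 1 → Nat.gcd b t = 1 := by
    intro a b h ha
    by_contra hb
    obtain ⟨p, hp, hpd⟩ := Nat.exists_prime_and_dvd hb
    have hpt := hpd.trans (Nat.gcd_dvd_right _ _)
    have hpa := (h p hp hpt).2 (hpd.trans (Nat.gcd_dvd_left _ _))
    have := Nat.dvd_gcd hpa hpt
    rw [ha] at this
    exact hp.one_lt.ne' (Nat.dvd_one.1 this)
  exact ⟨key h, key fun p hp hpt => (h p hp hpt).symm⟩

theorem Nat.Icc_filter_card_eq_count {p : ℕ → Prop} [DecidablePred p] {N : ℕ}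
    (hp : Function.Periodic p N) : ((Finset.Icc 1 N).filter p).card = Nat.count p N := by
  rw [← Nat.filter_Ico_card_eq_of_periodic 1 N p hp]
  congr 2
  ext x
  simp only [Finset.mem_Icc, Finset.mem_Ico]
  omega

/-- The number of integers in `[1, N]` coprime to `t` when all primes of `t` divide `N`. -/
theorem Nat.mul_card_Icc_coprime {t N : ℕ}
    (h : ∀ p : ℕ, p.Prime → p ∣ t → p ∣ N) :
    t * ((Finset.Icc 1 N).filter fun w => Nat.gcd w t = 1).card = t.totient * N := by
  have h1 : Function.Periodic (fun w => Nat.gcd w t = 1) N := fun x => by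
    refine propext (Nat.gcd_eq_one_congr_of_primes fun p hp hpt => ?_)
    exact (Nat.dvd_add_left (h p hp hpt))
  have h2 : Function.Periodic (fun w => Nat.gcd w t = 1) t := fun x => by simp
  -- Both `N` and `t` are periods of the predicate, so the count over length `N * t` is evaluated in
  -- two ways.
  rw [Nat.Icc_filter_card_eq_count h1, ← Nat.count_mul_of_periodic h1, mul_comm N,
    Nat.count_mul_of_periodic h2, mul_comm]
  congr 1
  rw [Nat.totient_eq_card_coprime, Nat.count_eq_card_filter_range]
  congr 1
  ext x
  simp [Nat.Coprime, Nat.gcd_comm]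

theorem Nat.card_Icc_filter_dvd {a N : ℕ} (ha : 0 < a) (P : ℕ → Prop) [DecidablePred P] :
    ((Finset.Icc 1 (a * N)).filter fun u => P u ∧ a ∣ u).card =
      ((Finset.Icc 1 N).filter fun v => P (a * v)).card := by
  symm
  refine Finset.card_bij (fun v _ => a * v) ?_ ?_ ?_
  · intro v hv
    simp only [Finset.mem_filter, Finset.mem_Icc] at hv ⊢
    exact ⟨⟨Nat.mul_pos ha hv.1.1, Nat.mul_le_mul_left a hv.1.2⟩, hv.2, dvd_mul_right _ _⟩
  · intro v _ w _ h
    exact Nat.eq_of_mul_eq_mul_left ha h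
  · intro u hu
    simp only [Finset.mem_filter, Finset.mem_Icc] at hu
    obtain ⟨⟨h1, h2⟩, h3, v, rfl⟩ := hu
    refine ⟨v, ?_, rfl⟩
    simp only [Finset.mem_filter, Finset.mem_Icc]
    exact ⟨⟨Nat.pos_of_mul_pos_left h1, Nat.le_of_mul_le_mul_left h2 ha⟩, h3⟩

/-- Without fixed points, `σ` exchanges the elements below their image with those above it. -/
theorem Finset.two_mul_card_filter_lt_of_involution {S : Finset ℕ} {σ : ℕ → ℕ}
    (hS : ∀ u ∈ S, σ u ∈ S) (hσ : ∀ u ∈ S, σ (σ u) = u) (hne : ∀ u ∈ S, σ u ≠ u) :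
    2 * (S.filter fun u => u < σ u).card = S.card := by
  rw [← Finset.card_filter_add_card_filter_not (s := S) (fun u => u < σ u), two_mul]
  congr 1
  refine Finset.card_bij (fun u _ => σ u) ?_ ?_ ?_
  · intro u hu
    rw [Finset.mem_filter] at hu ⊢
    refine ⟨hS u hu.1, ?_⟩
    rw [hσ u hu.1]
    exact hu.2.not_gt
  · intro u hu v hv h
    rw [Finset.mem_filter] at hu hv
    rw [← hσ u hu.1, ← hσ v hv.1, h]
  · intro v hv
    rw [Finset.mem_filter] at hv
    refine ⟨σ v, ?_, hσ v hv.1⟩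
    rw [Finset.mem_filter, hσ v hv.1]
    exact ⟨hS v hv.1, lt_of_le_of_ne (not_lt.1 hv.2) (hne v hv.1)⟩

/-! ### Divisor sums of `φ(t) / t` -/

/-- The sum of `φ(t) / t` over the divisors of `n`. -/
theorem Nat.sum_divisors_totient_div_coprime_mul {a b : ℕ} (h : a.Coprime b) :
    ∑ t ∈ (a * b).divisors, (t.totient : ℚ) / t =
      (∑ t ∈ a.divisors, (t.totient : ℚ) / t) * ∑ t ∈ b.divisors, (t.totient : ℚ) / t := by
  rw [Nat.divisors_mul, Finset.mul_def, Finset.sum_image h.mul_injOn_divisors, Finset.sum_product,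
    Finset.sum_mul_sum]
  refine Finset.sum_congr rfl fun x hx => Finset.sum_congr rfl fun y hy => ?_
  rw [Nat.totient_mul ((h.coprime_dvd_left (Nat.dvd_of_mem_divisors hx)).coprime_dvd_right
    (Nat.dvd_of_mem_divisors hy))]
  push_cast
  exact mul_div_mul_comm _ _ _ _

theorem Nat.sum_divisors_totient_div_prime_pow {p : ℕ} (hp : p.Prime) (k : ℕ) :
    ∑ t ∈ (p ^ k).divisors, (t.totient : ℚ) / t = 1 + k * (((p : ℚ) - 1) / p) := by
  rw [Nat.sum_divisors_prime_pow hp, Finset.sum_range_succ']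
  have hp0 : (p : ℚ) ≠ 0 := by exact_mod_cast hp.ne_zero
  have : ∀ i ∈ Finset.range k, ((p ^ (i + 1)).totient : ℚ) / (p ^ (i + 1) : ℕ) = ((p : ℚ) - 1) / p := by
    intro i _
    rw [Nat.totient_prime_pow_succ hp]
    push_cast [hp.one_le]
    field_simp
    ring
  rw [Finset.sum_congr rfl this]
  simp
  ring

theorem Nat.sum_divisors_totient_div {n : ℕ} (hn : n ≠ 0) :
    ∑ t ∈ n.divisors, (t.totient : ℚ) / t =
      ∏ p ∈ n.primeFactors, (1 + (padicValNat p n : ℚ) * (((p : ℚ) - 1) / p)) := by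
  rw [Nat.multiplicative_factorization (fun n => ∑ t ∈ n.divisors, (t.totient : ℚ) / t)
    (fun _ _ => Nat.sum_divisors_totient_div_coprime_mul) (by simp) hn, Finsupp.prod,
    Nat.support_factorization]
  refine Finset.prod_congr rfl fun p hp => ?_
  have hp' := Nat.prime_of_mem_primeFactors hp
  rw [Nat.sum_divisors_totient_div_prime_pow hp', Nat.factorization_def _ hp']

/-! ### The 2-adic relation between the two gcds -/

theorem Nat.gcd_two_pow_mul_odd {k l c d : ℕ} (hc : Odd c) (hd : Odd d) :
    Nat.gcd (2 ^ k * c) (2 ^ l * d) = 2 ^ min k l * Nat.gcd c d := by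
  have key : ∀ {k l c d : ℕ}, Odd c → k ≤ l →
      Nat.gcd (2 ^ k * c) (2 ^ l * d) = 2 ^ k * Nat.gcd c d := by
    intro k l c d hc h
    obtain ⟨i, rfl⟩ := Nat.exists_eq_add_of_le h
    rw [pow_add, mul_assoc, Nat.gcd_mul_left,
      Nat.Coprime.gcd_mul_left_cancel_right _ (Nat.Coprime.pow_left _ hc.coprime_two_left)]
  rcases le_total k l with h | h
  · rw [min_eq_left h, key hc h]
  · rw [min_eq_right h, Nat.gcd_comm, key hd h, Nat.gcd_comm c]

theorem padicValNat_two_pow_mul_odd {k c : ℕ} (hc : Odd c) : padicValNat 2 (2 ^ k * c) = k := by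
  rw [padicValNat.mul (by positivity) hc.pos.ne', padicValNat.prime_pow,
    padicValNat.eq_zero_of_not_dvd hc.not_two_dvd_nat, add_zero]

theorem two_le_min_padicValNat {q n : ℕ} (hn : 0 < n) (hq : q ≡ 3 [MOD 4]) (h8 : 8 ∣ n) :
    2 ≤ min (padicValNat 2 (n / 2)) (padicValNat 2 (q + 1)) := by
  have hq4 : q % 4 = 3 := hq
  refine le_min ?_ ?_
  · exact (padicValNat_dvd_iff_le (by omega)).1 (by norm_num; omega)
  · exact (padicValNat_dvd_iff_le (by omega)).1 (by norm_num; omega)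

/-- An odd prime of `n` divides `q - 1`, so it cannot divide `q + 1`; the factor `q + 1` thus
enlarges the gcd only by a power of 2. As `q ≡ 3` modulo 4, `q - 1` has a single factor 2, which
accounts for `n / 2` in place of `n` in the minimum. -/
theorem gcd_sq_sub_one {q n : ℕ} (hn : 0 < n) (hq : q ≡ 3 [MOD 4]) (h8 : 8 ∣ n)
    (hp : ∀ p : ℕ, p.Prime → p ∣ n → p ∣ q - 1) :
    Nat.gcd n (q ^ 2 - 1) =
      2 ^ min (padicValNat 2 (n / 2)) (padicValNat 2 (q + 1)) * Nat.gcd n (q - 1) := by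
  have hq4 : q % 4 = 3 := hq
  obtain ⟨k, c, hc, rfl⟩ := Nat.exists_eq_two_pow_mul_odd hn.ne'
  obtain ⟨s, b, hb, hsb⟩ := Nat.exists_eq_two_pow_mul_odd (n := q + 1) (by omega)
  obtain ⟨a, ha⟩ : ∃ a, q - 1 = 2 ^ 1 * a := ⟨(q - 1) / 2, by omega⟩
  have hao : Odd a := Nat.odd_iff.2 (by omega)
  have hk : k ≠ 0 := by
    rintro rfl
    have := Nat.odd_iff.1 hc
    omega
  obtain ⟨k, rfl⟩ := Nat.exists_eq_succ_of_ne_zero hk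
  have h2 : 2 ^ (k + 1) * c / 2 = 2 ^ k * c := by
    rw [pow_succ, mul_right_comm, Nat.mul_div_cancel _ two_pos]
  have hsq : q ^ 2 - 1 = 2 ^ (s + 1) * (a * b) := by
    have : q ^ 2 - 1 = (q + 1) * (q - 1) := by simpa using Nat.sq_sub_sq q 1
    rw [this, hsb, ha]
    ring
  have hcb : Nat.Coprime c b := by
    refine Nat.coprime_of_dvd fun p hpp hpc hpb => ?_
    have h1 := hp p hpp (hpc.mul_left _)
    have h3 : p ∣ q + 1 := hsb ▸ hpb.mul_left _
    have h4 : p ∣ 2 := by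
      have := Nat.dvd_sub h3 h1
      rwa [show q + 1 - (q - 1) = 2 by omega] at this
    rw [(Nat.prime_dvd_prime_iff_eq hpp Nat.prime_two).1 h4] at hpc
    exact hc.not_two_dvd_nat hpc
  rw [h2, padicValNat_two_pow_mul_odd hc, hsb, padicValNat_two_pow_mul_odd hb, hsq, ha,
    Nat.gcd_two_pow_mul_odd hc (hao.mul hb), Nat.gcd_two_pow_mul_odd hc hao,
    hcb.symm.gcd_mul_right_cancel_right, Nat.succ_eq_add_one, Nat.add_min_add_right,
    min_eq_right (Nat.le_add_left 1 k), pow_succ]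
  ring

/-! ### Orbits of multiplication by `q` -/

theorem Nat.dvd_mul_mod_iff {e d q u : ℕ} (hed : e ∣ d) (hqd : Nat.Coprime q d) :
    e ∣ (q * u) % d ↔ e ∣ u := by
  rw [Nat.dvd_mod_iff hed, (hqd.coprime_dvd_right hed).symm.dvd_mul_left]

/-- Multiplication by `q` modulo `d` is an involution preserving all the conditions, and `hu` rules
out fixed points. The extra condition `2 ^ j ∣ u` serves `j = 0` (all indices) and `j = r - 1`
(vanishing middle coefficient). -/
theorem two_mul_card_filter_trinomialIndices {q n r t j : ℕ} (h1 : 0 < q)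
    (hj : 2 ^ j ∣ Nat.gcd n (q ^ 2 - 1)) (hr : 2 ^ r ∣ Nat.gcd n (q ^ 2 - 1))
    (hu : ∀ u, Nat.gcd n (q ^ 2 - 1) ∣ (q - 1) * u ↔ 2 ^ r ∣ u)
    (ht : ∀ p : ℕ, p.Prime → p ∣ t → p ∣ Nat.gcd n (q ^ 2 - 1)) (hn : 0 < n) :
    2 * ((trinomialIndices q n r t).filter fun u => 2 ^ j ∣ u).card =
      ((Finset.Icc 1 (Nat.gcd n (q ^ 2 - 1))).filter fun u =>
        Nat.gcd u t = 1 ∧ ¬ 2 ^ r ∣ u ∧ 2 ^ j ∣ u).card := by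
  unfold trinomialIndices
  have hdpos : 0 < Nat.gcd n (q ^ 2 - 1) := Nat.gcd_pos_of_pos_left _ hn
  have hdq : Nat.gcd n (q ^ 2 - 1) ∣ q ^ 2 - 1 := Nat.gcd_dvd_right _ _
  generalize Nat.gcd n (q ^ 2 - 1) = d at *
  have hqq : q ^ 2 ≡ 1 [MOD d] := ((Nat.modEq_iff_dvd' (Nat.one_le_pow _ _ h1)).2 hdq).symm
  have hcop : Nat.Coprime q d := by
    have : Nat.gcd (q ^ 2) d = 1 := by rw [hqq.gcd_eq, Nat.gcd_one_left]
    exact (Nat.coprime_pow_left_iff two_pos _ _).1 this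
  rw [← Finset.two_mul_card_filter_lt_of_involution (S := (Finset.Icc 1 d).filter fun u =>
    Nat.gcd u t = 1 ∧ ¬ 2 ^ r ∣ u ∧ 2 ^ j ∣ u) (σ := fun u => (q * u) % d)]
  · congr 2
    ext u
    simp only [Finset.mem_filter]
    tauto
  · intro u hmem
    simp only [Finset.mem_filter, Finset.mem_Icc] at hmem ⊢
    obtain ⟨-, h3, h4, h5⟩ := hmem
    refine ⟨⟨Nat.pos_of_ne_zero fun h => h4 ?_, (Nat.mod_lt _ hdpos).le⟩, ?_, ?_, ?_⟩
    · rw [← Nat.dvd_mul_mod_iff hr hcop, h]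
      exact dvd_zero _
    · exact (Nat.gcd_eq_one_congr_of_primes fun p hp hpt =>
        Nat.dvd_mul_mod_iff (ht p hp hpt) hcop).2 h3
    · rwa [Nat.dvd_mul_mod_iff hr hcop]
    · rwa [Nat.dvd_mul_mod_iff hj hcop]
  · intro u hmem
    simp only [Finset.mem_filter, Finset.mem_Icc] at hmem
    obtain ⟨⟨-, h2⟩, h3, h4, h5⟩ := hmem
    -- The endpoint `u = d` is excluded because it is a multiple of `2 ^ r`; this makes `u` its own
    -- remainder.
    have hlt : u < d := lt_of_le_of_ne h2 fun h => h4 (h ▸ hr)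
    have : q * (q * u % d) ≡ u [MOD d] := calc
      q * (q * u % d) ≡ q * (q * u) [MOD d] := (Nat.mod_modEq _ _).mul_left _
      _ = q ^ 2 * u := by ring
      _ ≡ 1 * u [MOD d] := hqq.mul_right _
      _ = u := one_mul u
    have h6 : q * (q * u % d) % d = u % d := this
    rwa [Nat.mod_eq_of_lt hlt] at h6
  · intro u hmem h
    simp only [Finset.mem_filter, Finset.mem_Icc] at hmem
    obtain ⟨⟨-, h2⟩, h3, h4, h5⟩ := hmem
    have hlt : u < d := lt_of_le_of_ne h2 fun h => h4 (h ▸ hr)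
    refine h4 ((hu u).1 ?_)
    have : u ≡ q * u [MOD d] := by
      rw [Nat.ModEq, h, Nat.mod_eq_of_lt hlt]
    rw [Nat.sub_mul, one_mul]
    exact (Nat.modEq_iff_dvd' (Nat.le_mul_of_pos_left u h1)).1 this

/-- The number of `u ∈ [1, 2 ^ r d]` that are coprime to the odd number `t` and divisible by `2 ^ j`
but not by `2 ^ r`. -/
theorem mul_card_Icc_coprime_of_odd {d r t j : ℕ} (hj : j ≤ r) (hto : Odd t)
    (ht : ∀ p : ℕ, p.Prime → p ∣ t → p ∣ d) :
    t * ((Finset.Icc 1 (2 ^ r * d)).filter fun u =>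
        Nat.gcd u t = 1 ∧ ¬ 2 ^ r ∣ u ∧ 2 ^ j ∣ u).card + t.totient * d =
      t.totient * (2 ^ (r - j) * d) := by
  have hcop : ∀ i, Nat.Coprime (2 ^ i) t := fun i =>
    Nat.Coprime.pow_left _ hto.coprime_two_left
  -- Dividing the multiples of `2 ^ i` by `2 ^ i` does not affect coprimality to the odd `t`. The
  -- result follows by subtracting the case `i = r` from `i = j`.
  have hcount : ∀ i ≤ r, t * ((Finset.Icc 1 (2 ^ r * d)).filter fun u =>
      Nat.gcd u t = 1 ∧ 2 ^ i ∣ u).card = t.totient * (2 ^ (r - i) * d) := by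
    intro i hi
    have h2 : 2 ^ r * d = 2 ^ i * (2 ^ (r - i) * d) := by
      rw [← mul_assoc, ← pow_add, Nat.add_sub_cancel' hi]
    rw [h2, Nat.card_Icc_filter_dvd (by positivity) (fun u => Nat.gcd u t = 1)]
    simp_rw [(hcop i).gcd_mul_left_cancel]
    exact Nat.mul_card_Icc_coprime fun p hp hpt => (ht p hp hpt).mul_left _
  have h3 := hcount r le_rfl
  rw [Nat.sub_self, pow_zero, one_mul] at h3
  rw [← hcount j hj, ← h3, ← mul_add]
  congr 1
  rw [← Finset.card_filter_add_card_filter_not (s := (Finset.Icc 1 (2 ^ r * d)).filter fun u =>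
      Nat.gcd u t = 1 ∧ 2 ^ j ∣ u) (fun u => 2 ^ r ∣ u), Finset.filter_filter,
    Finset.filter_filter, add_comm]
  congr 2
  · ext u
    simp only [Finset.mem_filter]
    constructor
    · rintro ⟨h, h1, h2⟩
      exact ⟨h, ⟨h1, (pow_dvd_pow 2 hj).trans h2⟩, h2⟩
    · tauto
  · ext u
    simp only [Finset.mem_filter]
    tauto

/-! ### Irreducibility of binomials and trinomials -/

/-- If `a` is not a `p`-th power for any prime `p` dividing `n`, and `-1` is a square when `4 ∣ n`,
then `X ^ n - a` is irreducible. -/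
theorem X_pow_sub_C_irreducible_of_isSquare_neg_one {K : Type*} [Field K] {n : ℕ} (hn : n ≠ 0)
    (h4 : 4 ∣ n → IsSquare (-1 : K)) {a : K}
    (ha : ∀ p : ℕ, p.Prime → p ∣ n → ∀ b : K, b ^ p ≠ a) : Irreducible (X ^ n - C a) := by
  induction n using induction_on_primes generalizing K a with
  | zero => exact absurd rfl hn
  | one => simpa using irreducible_X_sub_C a
  | prime_mul p n hp IH =>
    rw [mul_comm]
    apply X_pow_mul_sub_C_irreducible
      (X_pow_sub_C_irreducible_of_prime hp (ha p hp (dvd_mul_right _ _)))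
    intro L _ _ x hx
    -- A non-integral `x` would have minimal polynomial 0 by convention, contradicting `hx`.
    have : IsIntegral K x := not_not.mp fun h ↦ by
      simpa only [degree_zero, degree_X_pow_sub_C hp.pos,
        WithBot.natCast_ne_bot] using congr_arg degree (hx.symm.trans (dif_neg h))
    apply IH (right_ne_zero_of_mul hn)
    · intro h
      simpa using (h4 (h.mul_left p)).map (algebraMap K (IntermediateField.adjoin K {x}))
    intro l hl hln b hb
    -- If `x = b ^ l` in `K(x)`, taking norms makes `a` (for `p` odd) or `-a` (for `p = 2`) an
    -- `l`-th power in `K`. The sign is absorbed by `-1 = (-1) ^ l` for odd `l`, and by a square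
    -- root of `-1` for `l = p = 2`, where `4` divides the exponent.
    have hnorm : (Algebra.norm K b) ^ l = (-1) ^ p * -a := by
      rw [← map_pow, hb, ← IntermediateField.adjoin.powerBasis_gen this,
        Algebra.PowerBasis.norm_gen_eq_coeff_zero_minpoly]
      simp [IntermediateField.minpoly_gen, hx, hp.ne_zero.symm]
    rcases hp.eq_two_or_odd' with rfl | hodd
    · rw [even_two.neg_one_pow, one_mul] at hnorm
      rcases hl.eq_two_or_odd' with rfl | hlo
      · obtain ⟨i, hi⟩ := h4 (by simpa using Nat.mul_dvd_mul_left 2 hln)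
        refine ha 2 hl (dvd_mul_right _ _) (i * Algebra.norm K b) ?_
        rw [mul_pow, hnorm, sq, ← hi]
        ring
      · refine ha l hl (hln.mul_left 2) (-Algebra.norm K b) ?_
        rw [hlo.neg_pow, hnorm, neg_neg]
    · refine ha l hl (hln.mul_left p) (Algebra.norm K b) ?_
      rw [hnorm, hodd.neg_one_pow]
      ring

theorem isCoprime_X_pow_sub_C {K : Type*} [Field K] {t : ℕ} {a b : K} (h : a ≠ b) :
    IsCoprime (X ^ t - C a : K[X]) (X ^ t - C b) := by
  refine ⟨-C (a - b)⁻¹, C (a - b)⁻¹, ?_⟩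
  have : C (a - b)⁻¹ * (C a - C b) = (1 : K[X]) := by
    rw [← C_sub, ← C_mul, inv_mul_cancel₀ (sub_ne_zero.2 h), C_1]
  linear_combination this

/-- A factor of `P` over `F` is fixed by `σ`; if `A` divides it, so does the conjugate of `A`, hence
by coprimality the whole product, and the cofactor is a unit. -/
theorem Polynomial.irreducible_of_map_eq_mul_map {F E : Type*} [Field F] [Field E] [Algebra F E]
    (σ : E ≃ₐ[F] E) {P : F[X]} {A : E[X]} (hA : Irreducible A)
    (hcop : IsCoprime A (A.map (σ : E →+* E)))
    (hP : P.map (algebraMap F E) = A * A.map (σ : E →+* E)) : Irreducible P := by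
  have hfix : ∀ f : F[X], (f.map (algebraMap F E)).map (σ : E →+* E) =
      f.map (algebraMap F E) := by
    intro f
    rw [Polynomial.map_map]
    congr 1
    ext x
    simp
  have key : ∀ f g : F[X], P = f * g → A ∣ f.map (algebraMap F E) → IsUnit g := by
    intro f g hfg hAf
    have h2 : A.map (σ : E →+* E) ∣ f.map (algebraMap F E) := by
      rw [← hfix f]
      exact Polynomial.map_dvd _ hAf
    obtain ⟨k, hk⟩ := hcop.mul_dvd hAf h2
    rw [← Polynomial.isUnit_map (algebraMap F E)]
    have h0 : A * A.map (σ : E →+* E) ≠ 0 := mul_ne_zero hA.ne_zero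
      ((Polynomial.map_ne_zero_iff (RingHom.injective _)).2 hA.ne_zero)
    refine IsUnit.of_mul_eq_one k (mul_left_cancel₀ h0 ?_)
    rw [mul_one, mul_left_comm, ← hk, mul_comm, ← Polynomial.map_mul, ← hfg, hP]
  constructor
  · intro h
    have h1 := (Polynomial.isUnit_map (algebraMap F E)).2 h
    rw [hP] at h1
    exact hA.not_isUnit (isUnit_of_mul_isUnit_left h1)
  · intro f g hfg
    have : A ∣ f.map (algebraMap F E) * g.map (algebraMap F E) := by
      rw [← Polynomial.map_mul, ← hfg, hP]
      exact dvd_mul_right _ _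
    rcases hA.prime.dvd_or_dvd this with h | h
    · exact Or.inr (key f g hfg h)
    · exact Or.inl (key g f (hfg.trans (mul_comm _ _)) h)

theorem trinomial_map {F E : Type*} [Field F] [Field E] [Algebra F E] {t : ℕ} {c N : F} {β γ : E}
    (hc : algebraMap F E c = β + γ) (hN : algebraMap F E N = β * γ) :
    (X ^ (2 * t) - C c * X ^ t + C N : F[X]).map (algebraMap F E) =
      (X ^ t - C β) * (X ^ t - C γ) := by
  simp only [Polynomial.map_add, Polynomial.map_sub, Polynomial.map_mul, Polynomial.map_pow,
    map_X, map_C, hc, hN, C_add, C_mul]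
  ring

theorem irreducible_trinomial {F E : Type*} [Field F] [Finite F] [Field E] [Finite E] [Algebra F E]
    {t : ℕ} {c N : F} {β : E} (hc : algebraMap F E c = β + β ^ Nat.card F)
    (hN : algebraMap F E N = β * β ^ Nat.card F) (hβ : β ≠ β ^ Nat.card F)
    (hirr : Irreducible (X ^ t - C β)) : Irreducible (X ^ (2 * t) - C c * X ^ t + C N) := by
  have := Fintype.ofFinite F
  let σ := FiniteField.frobeniusAlgEquivOfAlgebraic F E
  have hσ : (X ^ t - C β).map (σ : E →+* E) = X ^ t - C (β ^ Nat.card F) := by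
    have : σ β = β ^ Nat.card F := by
      simp [σ]
    simp [this]
  refine Polynomial.irreducible_of_map_eq_mul_map σ hirr ?_ ?_
  · rw [hσ]
    exact isCoprime_X_pow_sub_C hβ
  · rw [hσ]
    exact trinomial_map hc hN

/-! ### Divisibility, non-powers and the shape of the factors -/

theorem X_pow_sub_C_dvd_X_pow_sub_one {K : Type*} [Field K] {t k : ℕ} {a : K} (h : a ^ k = 1) :
    (X ^ t - C a : K[X]) ∣ X ^ (t * k) - 1 := by
  rw [pow_mul, ← C_1, ← h, C_pow]
  exact sub_dvd_pow_sub_pow _ _ _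

theorem trinomial_dvd_X_pow_sub_one {F E : Type*} [Field F] [Field E] [Algebra F E] {t k : ℕ}
    {c N : F} {β γ : E} (hc : algebraMap F E c = β + γ) (hN : algebraMap F E N = β * γ)
    (hne : β ≠ γ) (hβ : β ^ k = 1) (hγ : γ ^ k = 1) :
    (X ^ (2 * t) - C c * X ^ t + C N : F[X]) ∣ X ^ (t * k) - 1 := by
  rw [← Polynomial.map_dvd_map' (algebraMap F E), trinomial_map hc hN]
  simpa using (isCoprime_X_pow_sub_C hne).mul_dvd (X_pow_sub_C_dvd_X_pow_sub_one hβ)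
    (X_pow_sub_C_dvd_X_pow_sub_one hγ)

/-- Exponents of `g` are defined modulo the group order, a multiple of `p`, so divisibility of the
exponent by `p` is well defined. -/
theorem pow_ne_generator_pow {K : Type*} [Field K] [Finite K] {g : Kˣ}
    (hg : ∀ x : Kˣ, x ∈ Subgroup.zpowers g) {p k : ℕ} (hp : p ∣ Nat.card Kˣ) (hk : ¬ p ∣ k)
    (b : K) : b ^ p ≠ (g : K) ^ k := by
  intro h
  have hp0 : p ≠ 0 := fun h0 => Nat.card_pos.ne' (Nat.eq_zero_of_zero_dvd (h0 ▸ hp))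
  have hb : b ≠ 0 := by
    rintro rfl
    rw [zero_pow hp0] at h
    exact pow_ne_zero k g.ne_zero h.symm
  obtain ⟨j, hj⟩ := mem_powers_iff_mem_zpowers.2 (hg (Units.mk0 b hb))
  have h1 : g ^ (j * p) = g ^ k := by
    ext
    have : ((g ^ j : Kˣ) : K) = b := by
      simp only at hj
      rw [hj, Units.val_mk0]
    push_cast at this ⊢
    rw [pow_mul, this, h]
  rw [pow_eq_pow_iff_modEq, orderOf_eq_card_of_forall_mem_zpowers hg] at h1
  exact hk ((h1.dvd_iff hp).1 (dvd_mul_left _ _))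

theorem natDegree_X_pow_sub_C_mul_X_pow_add_C {K : Type*} [Field K] (t : ℕ) (c N : K) :
    (X ^ (2 * t) - C c * X ^ t + C N).natDegree = 2 * t := by
  have h : (X ^ (2 * t) - C c * X ^ t + C N) = (X ^ 2 - C c * X + C N).comp (X ^ t) := by
    simp [pow_mul']
  have h2 : (X ^ 2 - C c * X + C N : K[X]).natDegree = 2 := by compute_degree!
  rw [h, natDegree_comp, h2, natDegree_X_pow]

theorem monic_X_pow_sub_C_mul_X_pow_add_C {K : Type*} [Field K] {t : ℕ} (ht : t ≠ 0) (c N : K) :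
    (X ^ (2 * t) - C c * X ^ t + C N).Monic := by
  have h : (X ^ (2 * t) - C c * X ^ t + C N) = (X ^ 2 - C c * X + C N).comp (X ^ t) := by
    simp [pow_mul']
  have h2 : (X ^ 2 - C c * X + C N : K[X]).Monic := by monicity!
  rw [h]
  exact h2.comp (monic_X_pow t) (by simpa using ht)

theorem card_support_X_pow_sub_C {K : Type*} [Field K] {t : ℕ} (ht : t ≠ 0) {a : K} (ha : a ≠ 0) :
    (X ^ t - C a).support.card = 2 := by
  have := card_support_binomial ht (one_ne_zero (α := K)) (neg_ne_zero.2 ha)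
  simpa [sub_eq_add_neg] using this

theorem card_support_X_pow_sub_C_mul_X_pow_add_C {K : Type*} [Field K] [DecidableEq K] {t : ℕ} (ht : t ≠ 0)
    {c N : K} (hN : N ≠ 0) :
    (X ^ (2 * t) - C c * X ^ t + C N).support.card = if c = 0 then 2 else 3 := by
  split_ifs with hc
  · have := card_support_X_pow_sub_C (K := K) (mul_ne_zero two_ne_zero ht) (neg_ne_zero.2 hN)
    simpa [hc] using this
  · have := card_support_trinomial (k := 0) (m := t) (n := 2 * t) (by omega) (by omega) hN
      (neg_ne_zero.2 hc) (one_ne_zero (α := K))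
    rw [← this]
    congr 2
    simp
    ring

/-! ### Sizes of the index sets -/

/-- After cancelling `gcd(n, q - 1)`, the remaining cofactor of `q - 1` is odd, since the gcd is
even and `4 ∤ q - 1`. -/
theorem gcd_sub_one_dvd_mul_iff {q n r : ℕ} (hn : 0 < n) (hq : q ≡ 3 [MOD 4])
    (h8 : 8 ∣ n) (hd : Nat.gcd n (q ^ 2 - 1) = 2 ^ r * Nat.gcd n (q - 1)) (u : ℕ) :
    Nat.gcd n (q ^ 2 - 1) ∣ (q - 1) * u ↔ 2 ^ r ∣ u := by
  have hq4 : q % 4 = 3 := hq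
  have h2 : 2 ∣ Nat.gcd n (q - 1) := Nat.dvd_gcd (by omega) (by omega)
  obtain ⟨l, hl⟩ := Nat.gcd_dvd_right n (q - 1)
  have hpos : 0 < Nat.gcd n (q - 1) := Nat.gcd_pos_of_pos_left _ hn
  have hlo : Odd l := by
    rw [← Nat.not_even_iff_odd, even_iff_two_dvd]
    intro h
    have := Nat.mul_dvd_mul h2 h
    omega
  rw [hd]
  nth_rewrite 2 [hl]
  rw [mul_assoc, mul_comm, Nat.mul_dvd_mul_iff_left hpos,
    (Nat.Coprime.pow_left r hlo.coprime_two_left).dvd_mul_left]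

theorem mul_card_binomialIndices {q n t : ℕ} (hp : ∀ p : ℕ, p.Prime → p ∣ n → p ∣ q - 1)
    (ht : t ∣ n) : t * (binomialIndices q n t).card = t.totient * Nat.gcd n (q - 1) :=
  Nat.mul_card_Icc_coprime fun p hpp hpt => Nat.dvd_gcd (hpt.trans ht) (hp p hpp (hpt.trans ht))

theorem two_mul_card_trinomialIndices_of_even {q n r t : ℕ} (hn : 0 < n) (hq : q ≡ 3 [MOD 4])
    (h8 : 8 ∣ n) (hp : ∀ p : ℕ, p.Prime → p ∣ n → p ∣ q - 1)
    (hd : Nat.gcd n (q ^ 2 - 1) = 2 ^ r * Nat.gcd n (q - 1)) (hr : 2 ≤ r)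
    (ht : t ∣ n) (hte : Even t) :
    2 * (t * (trinomialIndices q n r t).card) = t.totient * (2 ^ r * Nat.gcd n (q - 1)) := by
  have hq4 : q % 4 = 3 := hq
  have hpd : ∀ p : ℕ, p.Prime → p ∣ t → p ∣ Nat.gcd n (q ^ 2 - 1) := fun p hpp hpt =>
    hd ▸ (Nat.dvd_gcd (hpt.trans ht) (hp p hpp (hpt.trans ht))).mul_left _
  have h := two_mul_card_filter_trinomialIndices (t := t) (j := 0) (by omega) (by simp)
    (hd ▸ dvd_mul_right _ _) (gcd_sub_one_dvd_mul_iff hn hq h8 hd) hpd hn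
  simp only [pow_zero, one_dvd, Finset.filter_true, and_true] at h
  rw [mul_left_comm, h, ← hd, ← Nat.mul_card_Icc_coprime hpd]
  congr 2
  -- For even `t`, coprimality makes `u` odd, so `2 ^ r ∤ u` is automatic.
  refine Finset.filter_congr fun u _ => and_iff_left_of_imp fun hut h2 => ?_
  have := Nat.dvd_gcd ((dvd_pow_self 2 (by omega : r ≠ 0)).trans h2) hte.two_dvd
  omega

theorem two_mul_card_filter_trinomialIndices_of_odd {q n r t j : ℕ} (hn : 0 < n)
    (hq : q ≡ 3 [MOD 4]) (h8 : 8 ∣ n) (hp : ∀ p : ℕ, p.Prime → p ∣ n → p ∣ q - 1)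
    (hd : Nat.gcd n (q ^ 2 - 1) = 2 ^ r * Nat.gcd n (q - 1))
    (ht : t ∣ n) (hto : Odd t) (hj : j ≤ r) :
    2 * (t * ((trinomialIndices q n r t).filter fun u => 2 ^ j ∣ u).card) +
      t.totient * Nat.gcd n (q - 1) = t.totient * (2 ^ (r - j) * Nat.gcd n (q - 1)) := by
  have hq4 : q % 4 = 3 := hq
  have hpd : ∀ p : ℕ, p.Prime → p ∣ t → p ∣ Nat.gcd n (q - 1) := fun p hpp hpt =>
    Nat.dvd_gcd (hpt.trans ht) (hp p hpp (hpt.trans ht))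
  have hrd : 2 ^ r ∣ Nat.gcd n (q ^ 2 - 1) := hd ▸ dvd_mul_right _ _
  have h := two_mul_card_filter_trinomialIndices (t := t) (j := j) (by omega)
    ((pow_dvd_pow 2 hj).trans hrd) hrd (gcd_sub_one_dvd_mul_iff hn hq h8 hd)
    (fun p hpp hpt => hd ▸ (hpd p hpp hpt).mul_left _) hn
  rw [mul_left_comm, h, hd]
  exact mul_card_Icc_coprime_of_odd hj hto hpd

theorem two_mul_card_trinomialIndices_of_odd {q n r t : ℕ} (hn : 0 < n)
    (hq : q ≡ 3 [MOD 4]) (h8 : 8 ∣ n) (hp : ∀ p : ℕ, p.Prime → p ∣ n → p ∣ q - 1)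
    (hd : Nat.gcd n (q ^ 2 - 1) = 2 ^ r * Nat.gcd n (q - 1)) (ht : t ∣ n) (hto : Odd t) :
    2 * (t * (trinomialIndices q n r t).card) + t.totient * Nat.gcd n (q - 1) =
      t.totient * (2 ^ r * Nat.gcd n (q - 1)) := by
  simpa using two_mul_card_filter_trinomialIndices_of_odd (j := 0) hn hq h8 hp hd ht hto
    (Nat.zero_le _)

/-- The degrees of the listed factors of `X ^ n - 1` add up to `n`. -/
theorem sum_card_mul_natDegree {q n m r : ℕ} (hn : 0 < n) (hq : q ≡ 3 [MOD 4])
    (h8 : 8 ∣ n) (hp : ∀ p : ℕ, p.Prime → p ∣ n → p ∣ q - 1)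
    (hd : Nat.gcd n (q ^ 2 - 1) = 2 ^ r * Nat.gcd n (q - 1)) (hr : 2 ≤ r)
    (hm : n = m * Nat.gcd n (q ^ 2 - 1)) :
    ∑ t ∈ m.divisors.filter (fun t => Odd t), (binomialIndices q n t).card * t +
      ∑ t ∈ m.divisors, (trinomialIndices q n r t).card * (2 * t) = n := by
  have hmn : ∀ t ∈ m.divisors, t ∣ n := fun t ht =>
    (Nat.dvd_of_mem_divisors ht).trans ⟨_, hm⟩
  rw [Finset.sum_filter, ← Finset.sum_add_distrib]
  -- Writing `n` as `∑ φ(t) * d` over `t ∣ m` allows a comparison term by term.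
  conv_rhs => rw [hm, ← Nat.sum_totient m, Finset.sum_mul, hd]
  refine Finset.sum_congr rfl fun t ht => ?_
  split_ifs with hto
  · rw [← two_mul_card_trinomialIndices_of_odd hn hq h8 hp hd (hmn t ht) hto,
      ← mul_card_binomialIndices hp (hmn t ht)]
    ring
  · rw [← two_mul_card_trinomialIndices_of_even hn hq h8 hp hd hr (hmn t ht)
      (Nat.not_odd_iff_even.1 hto)]
    ring

theorem Nat.filter_odd_divisors_two_pow_mul {k c : ℕ} (hc : Odd c) :
    (2 ^ k * c).divisors.filter (fun t => Odd t) = c.divisors := by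
  ext t
  simp only [Finset.mem_filter, Nat.mem_divisors]
  constructor
  · rintro ⟨⟨h, -⟩, ho⟩
    exact ⟨(Nat.Coprime.pow_right k ho.coprime_two_right).dvd_of_dvd_mul_left h, hc.pos.ne'⟩
  · rintro ⟨h, -⟩
    exact ⟨⟨h.mul_left _, mul_ne_zero (by positivity) hc.pos.ne'⟩, hc.of_dvd_nat h⟩

theorem Nat.filter_odd_primeFactors_two_pow_mul {k c : ℕ} (hc : Odd c) :
    (2 ^ k * c).primeFactors.filter (fun p => Odd p) = c.primeFactors := by
  ext p
  have := congrArg (fun s => p ∈ s) (Nat.filter_odd_divisors_two_pow_mul (k := k) hc)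
  simp only [Finset.mem_filter, Nat.mem_divisors, Nat.mem_primeFactors, eq_iff_iff] at this ⊢
  tauto

/-- The total number of listed factors of `X ^ n - 1`. -/
theorem sum_card_indices {q n m r : ℕ} (hn : 0 < n) (hq : q ≡ 3 [MOD 4])
    (h8 : 8 ∣ n) (hp : ∀ p : ℕ, p.Prime → p ∣ n → p ∣ q - 1)
    (hd : Nat.gcd n (q ^ 2 - 1) = 2 ^ r * Nat.gcd n (q - 1)) (hr : 2 ≤ r)
    (hm : n = m * Nat.gcd n (q ^ 2 - 1)) :
    ((∑ t ∈ m.divisors.filter (fun t => Odd t), (binomialIndices q n t).card +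
      ∑ t ∈ m.divisors, (trinomialIndices q n r t).card : ℕ) : ℚ) =
      (Nat.gcd n (q - 1) : ℚ) *
        (1 / 2 + (2 : ℚ) ^ ((r : ℤ) - 2) * (2 + (padicValNat 2 m : ℚ))) *
        ∏ p ∈ m.primeFactors.filter (fun p => Odd p),
          (1 + (padicValNat p m : ℚ) * (((p : ℚ) - 1) / p)) := by
  have hmn : ∀ t ∈ m.divisors, t ∣ n := fun t ht =>
    (Nat.dvd_of_mem_divisors ht).trans ⟨_, hm⟩
  have hm0 : m ≠ 0 := by
    rintro rfl
    omega
  have h1 : ((∑ t ∈ m.divisors.filter (fun t => Odd t), (binomialIndices q n t).card +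
      ∑ t ∈ m.divisors, (trinomialIndices q n r t).card : ℕ) : ℚ) =
      Nat.gcd n (q - 1) * (1 / 2 * ∑ t ∈ m.divisors.filter (fun t => Odd t), (t.totient : ℚ) / t +
        2 ^ r / 2 * ∑ t ∈ m.divisors, (t.totient : ℚ) / t) := by
    push_cast
    rw [Finset.sum_filter, Finset.sum_filter, ← Finset.sum_add_distrib, Finset.mul_sum,
      Finset.mul_sum, ← Finset.sum_add_distrib, Finset.mul_sum]
    refine Finset.sum_congr rfl fun t ht => ?_
    have ht0 : (t : ℚ) ≠ 0 := by exact_mod_cast (Nat.pos_of_mem_divisors ht).ne'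
    split_ifs with hto
    · have h2 := two_mul_card_trinomialIndices_of_odd hn hq h8 hp hd (hmn t ht) hto
      have h3 := mul_card_binomialIndices hp (hmn t ht)
      apply_fun ((↑) : ℕ → ℚ) at h2 h3
      push_cast at h2 h3
      field_simp
      linear_combination h2 + 2 * h3
    · have h2 := two_mul_card_trinomialIndices_of_even hn hq h8 hp hd hr (hmn t ht)
        (Nat.not_odd_iff_even.1 hto)
      apply_fun ((↑) : ℕ → ℚ) at h2
      push_cast at h2
      field_simp
      linear_combination h2
  rw [h1]
  -- The power of 2 in `m` contributes `1 + k / 2` to the full divisor sum and nothing to the odd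
  -- one; `2 ^ r / 2 * (1 + k / 2)` is `2 ^ (r - 2) * (2 + k)`.
  obtain ⟨k, c, hc, rfl⟩ := Nat.exists_eq_two_pow_mul_odd hm0
  obtain ⟨s, rfl⟩ := Nat.exists_eq_add_of_le hr
  have hval : ∀ p ∈ c.primeFactors, padicValNat p (2 ^ k * c) = padicValNat p c := by
    intro p hpc
    have hpp := Nat.prime_of_mem_primeFactors hpc
    have : Fact p.Prime := ⟨hpp⟩
    have hpo : Odd p := hc.of_dvd_nat (Nat.dvd_of_mem_primeFactors hpc)
    rw [padicValNat.mul (by positivity) hc.pos.ne', padicValNat.eq_zero_of_not_dvd, zero_add]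
    intro h
    have h2 := (Nat.prime_dvd_prime_iff_eq hpp Nat.prime_two).1 (hpp.dvd_of_dvd_pow h)
    subst h2
    exact absurd hpo (by decide)
  rw [Nat.filter_odd_divisors_two_pow_mul hc, Nat.filter_odd_primeFactors_two_pow_mul hc,
    padicValNat_two_pow_mul_odd hc, Nat.sum_divisors_totient_div_coprime_mul
      (Nat.Coprime.pow_left k hc.coprime_two_left),
    Nat.sum_divisors_totient_div_prime_pow Nat.prime_two,
    Finset.prod_congr rfl fun p hpc => by rw [hval p hpc], ← Nat.sum_divisors_totient_div hc.pos.ne',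
    show ((2 + s : ℕ) : ℤ) - 2 = s by push_cast; ring, zpow_natCast, pow_add]
  push_cast
  ring

/-! ### From a list of factors to the complete factorization -/

theorem generator_pow_mul_eq_iff {K : Type*} [Field K] {g : Kˣ}
    (hg : ∀ x : Kˣ, x ∈ Subgroup.zpowers g) {d l : ℕ} (hl : l ≠ 0) (h : Nat.card Kˣ = d * l)
    (a b : ℕ) : (g : K) ^ (a * l) = (g : K) ^ (b * l) ↔ a ≡ b [MOD d] := by
  rw [← Units.val_pow_eq_pow_val, ← Units.val_pow_eq_pow_val, Units.val_inj, pow_eq_pow_iff_modEq,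
    orderOf_eq_card_of_forall_mem_zpowers hg, h]
  exact Nat.ModEq.mul_right_cancel_iff' hl

/-- A family of distinct monic irreducible divisors of `P` whose degrees add up to that of `P`
consists of all monic irreducible divisors of `P`, and `P` is its product. -/
theorem eq_prod_and_monicIrreducibleFactors_eq {F ι : Type*} [Field F] {P : F[X]} (hP : P.Monic)
    {S : Finset ι} {f : ι → F[X]} (hmonic : ∀ i ∈ S, (f i).Monic)
    (hirr : ∀ i ∈ S, Irreducible (f i)) (hinj : Set.InjOn f S) (hdvd : ∀ i ∈ S, f i ∣ P)
    (hdeg : ∑ i ∈ S, (f i).natDegree = P.natDegree) :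
    P = ∏ i ∈ S, f i ∧ monicIrreducibleFactors P = f '' S := by
  have hprod : P = ∏ i ∈ S, f i := by
    refine (Polynomial.eq_of_monic_of_dvd_of_natDegree_le (monic_prod_of_monic _ _ hmonic) hP
      ?_ ?_)
    · refine Finset.prod_dvd_of_coprime (fun i hi j hj hij => ?_) hdvd
      refine (hirr i hi).coprime_iff_not_dvd.2 fun h => hij (hinj hi hj ?_)
      exact eq_of_monic_of_associated (hmonic i hi) (hmonic j hj)
        ((hirr i hi).associated_of_dvd (hirr j hj) h)
    · rw [natDegree_prod_of_monic _ _ hmonic, hdeg]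
  refine ⟨hprod, ?_⟩
  ext g
  simp only [monicIrreducibleFactors, Set.mem_ofPred_eq, Set.mem_image, Finset.mem_coe]
  constructor
  · rintro ⟨hg, hgi, hgP⟩
    rw [hprod] at hgP
    obtain ⟨i, hi, h⟩ := (hgi.prime.dvd_finsetProd_iff f).1 hgP
    exact ⟨i, hi, (eq_of_monic_of_associated hg (hmonic i hi)
      (hgi.associated_of_dvd (hirr i hi) h)).symm⟩
  · rintro ⟨i, hi, rfl⟩
    exact ⟨hmonic i hi, hirr i hi, hdvd i hi⟩

/-- The version of `eq_prod_and_monicIrreducibleFactors_eq` for two doubly indexed families. -/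
theorem eq_prod_mul_prod_and_ncard {F : Type*} [Field F] {P : F[X]} (hP : P.Monic)
    {A B : Finset ℕ} {I J : ℕ → Finset ℕ} {f g : ℕ → ℕ → F[X]}
    (hfm : ∀ t ∈ A, ∀ w ∈ I t, (f t w).Monic) (hgm : ∀ t ∈ B, ∀ u ∈ J t, (g t u).Monic)
    (hfi : ∀ t ∈ A, ∀ w ∈ I t, Irreducible (f t w))
    (hgi : ∀ t ∈ B, ∀ u ∈ J t, Irreducible (g t u))
    (hfd : ∀ t ∈ A, ∀ w ∈ I t, f t w ∣ P) (hgd : ∀ t ∈ B, ∀ u ∈ J t, g t u ∣ P)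
    (hff : ∀ t ∈ A, ∀ w ∈ I t, ∀ t' ∈ A, ∀ w' ∈ I t', f t w = f t' w' → t = t' ∧ w = w')
    (hgg : ∀ t ∈ B, ∀ u ∈ J t, ∀ t' ∈ B, ∀ u' ∈ J t', g t u = g t' u' → t = t' ∧ u = u')
    (hfg : ∀ t ∈ A, ∀ w ∈ I t, ∀ t' ∈ B, ∀ u ∈ J t', f t w ≠ g t' u)
    (hdeg : ∑ t ∈ A, ∑ w ∈ I t, (f t w).natDegree + ∑ t ∈ B, ∑ u ∈ J t, (g t u).natDegree =
      P.natDegree) :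
    P = (∏ t ∈ A, ∏ w ∈ I t, f t w) * (∏ t ∈ B, ∏ u ∈ J t, g t u) ∧
      ∀ (Q : F[X] → Prop) [DecidablePred Q], {h ∈ monicIrreducibleFactors P | Q h}.ncard =
        ∑ t ∈ A, ((I t).filter fun w => Q (f t w)).card +
          ∑ t ∈ B, ((J t).filter fun u => Q (g t u)).card := by
  -- Both families are packed into one, indexed by a disjoint sum.
  let φ : (Σ _ : ℕ, ℕ) ⊕ (Σ _ : ℕ, ℕ) → F[X] :=
    Sum.elim (fun x => f x.1 x.2) (fun x => g x.1 x.2)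
  have hinj : Set.InjOn φ ((A.sigma I).disjSum (B.sigma J)) := by
    rintro (⟨t, w⟩ | ⟨t, w⟩) hx (⟨t', w'⟩ | ⟨t', w'⟩) hy h <;>
      simp only [Finset.mem_coe, Finset.inl_mem_disjSum, Finset.inr_mem_disjSum,
        Finset.mem_sigma] at hx hy
    · obtain ⟨rfl, rfl⟩ := hff t hx.1 w hx.2 t' hy.1 w' hy.2 h
      rfl
    · exact absurd h (hfg t hx.1 w hx.2 t' hy.1 w' hy.2)
    · exact absurd h.symm (hfg t' hy.1 w' hy.2 t hx.1 w hx.2)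
    · obtain ⟨rfl, rfl⟩ := hgg t hx.1 w hx.2 t' hy.1 w' hy.2 h
      rfl
  have hall : ∀ R : F[X] → Prop, (∀ t ∈ A, ∀ w ∈ I t, R (f t w)) →
      (∀ t ∈ B, ∀ u ∈ J t, R (g t u)) → ∀ x ∈ (A.sigma I).disjSum (B.sigma J), R (φ x) := by
    rintro R h1 h2 (⟨t, w⟩ | ⟨t, w⟩) hx <;>
      simp only [Finset.inl_mem_disjSum, Finset.inr_mem_disjSum, Finset.mem_sigma] at hx
    · exact h1 t hx.1 w hx.2
    · exact h2 t hx.1 w hx.2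
  obtain ⟨h1, h2⟩ := eq_prod_and_monicIrreducibleFactors_eq hP (hall _ hfm hgm) (hall _ hfi hgi)
    hinj (hall (fun h => h ∣ P) hfd hgd) (by
      rw [Finset.sum_disjSum, Finset.sum_sigma, Finset.sum_sigma]
      exact hdeg)
  refine ⟨?_, fun Q _ => ?_⟩
  · rw [Finset.prod_disjSum, Finset.prod_sigma, Finset.prod_sigma] at h1
    exact h1
  · have h3 : {h ∈ monicIrreducibleFactors P | Q h} =
        φ '' (((A.sigma I).disjSum (B.sigma J)).filter fun x => Q (φ x) : Finset _) := by
      rw [h2]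
      ext h
      simp only [Set.mem_ofPred_eq, Set.mem_image, Finset.mem_coe, Finset.mem_filter]
      constructor
      · rintro ⟨⟨x, hx, rfl⟩, hQ⟩
        exact ⟨x, ⟨hx, hQ⟩, rfl⟩
      · rintro ⟨x, ⟨hx, hQ⟩, rfl⟩
        exact ⟨⟨x, hx, rfl⟩, hQ⟩
    rw [h3, Set.InjOn.ncard_image (hinj.mono (Finset.coe_subset.2 (Finset.filter_subset _ _))), Set.ncard_coe_finset,
      Finset.card_filter, Finset.sum_disjSum, Finset.sum_sigma, Finset.sum_sigma]
    simp_rw [Finset.card_filter]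
    rfl

theorem prime_dvd_sub_one_of_radical_dvd {n k : ℕ} (hn : n ≠ 0)
    (hrad : UniqueFactorizationMonoid.radical n ∣ k) (p : ℕ) (hp : p.Prime) (h : p ∣ n) : p ∣ k :=
  ((UniqueFactorizationMonoid.dvd_radical_iff_of_irreducible hp hn).2 h).trans hrad

/-- The extension has degree 2; the trace supplies the middle coefficient as an element of `F`. -/
theorem algebraMap_trace_of_card_eq_sq {F E : Type*} [Field F] [Finite F] [Field E] [Finite E]
    [Algebra F E] (h : Nat.card E = Nat.card F ^ 2) (x : E) :
    algebraMap F E (Algebra.trace F E x) = x + x ^ Nat.card F := by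
  have hr : Module.finrank F E = 2 := by
    rw [Module.natCard_eq_pow_finrank (K := F) (V := E)] at h
    exact Nat.pow_right_injective Finite.one_lt_card h
  rw [FiniteField.algebraMap_trace_eq_sum_pow, hr]
  simp [Finset.sum_range_succ]

theorem eq_or_eq_of_add_eq_of_mul_eq {K : Type*} [Field K] {a b c d : K} (h1 : a + b = c + d)
    (h2 : a * b = c * d) : a = c ∨ a = d := by
  have : (a - c) * (a - d) = 0 := by linear_combination a * h1 - h2
  rcases mul_eq_zero.1 this with h | h
  · exact Or.inl (sub_eq_zero.1 h)
  · exact Or.inr (sub_eq_zero.1 h)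

theorem X_pow_sub_C_mul_X_pow_add_C_inj {K : Type*} [Field K] {t t' : ℕ} (ht : t ≠ 0)
    {c c' N N' : K} (h : (X ^ (2 * t) - C c * X ^ t + C N : K[X]) =
      X ^ (2 * t') - C c' * X ^ t' + C N') : t = t' ∧ c = c' ∧ N = N' := by
  have h1 := congrArg natDegree h
  rw [natDegree_X_pow_sub_C_mul_X_pow_add_C, natDegree_X_pow_sub_C_mul_X_pow_add_C] at h1
  obtain rfl : t = t' := by omega
  have h2 := congrArg (fun f => coeff f t) h
  have h3 := congrArg (fun f => coeff f 0) h
  have e1 : t ≠ 2 * t := by omega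
  have e2 : (0 : ℕ) ≠ t := ht.symm
  simp [coeff_X_pow, coeff_C, ht, e1, e2] at h2 h3
  exact ⟨rfl, h2, h3⟩

theorem X_pow_sub_C_inj {K : Type*} [Field K] {t t' : ℕ} {a a' : K}
    (h : (X ^ t - C a : K[X]) = X ^ t' - C a') : t = t' ∧ a = a' := by
  have h1 := congrArg natDegree h
  rw [natDegree_X_pow_sub_C, natDegree_X_pow_sub_C] at h1
  subst h1
  exact ⟨rfl, C_injective (sub_right_injective h)⟩

/-! ### The factorization and the counts -/

theorem mainTheorem4 {F E : Type*} [Field F] [Finite F] [Field E] [Finite E] [Algebra F E]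
    (q n : ℕ) (hF : Nat.card F = q) (hE : Nat.card E = q ^ 2)
    (hn : 0 < n) (hq : q ≡ 3 [MOD 4]) (h8 : 8 ∣ n)
    (hrad : UniqueFactorizationMonoid.radical n ∣ q - 1)
    (θ : Fˣ) (hθ : ∀ x : Fˣ, x ∈ Subgroup.zpowers θ)
    (α : Eˣ) (hα : ∀ x : Eˣ, x ∈ Subgroup.zpowers α)
    (hαθ : (α : E) ^ (q + 1) = algebraMap F E (θ : F))
    (m l₁ l₂ r : ℕ)
    (hm : m = n / Nat.gcd n (q ^ 2 - 1))
    (hl₁ : l₁ = (q - 1) / Nat.gcd (q - 1) n)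
    (hl₂ : l₂ = (q ^ 2 - 1) / Nat.gcd (q ^ 2 - 1) n)
    (hr : r = min (padicValNat 2 (n / 2)) (padicValNat 2 (q + 1))) :
    -- (a) `c u` is the element of `F` that `α ^ (u l₂) + α ^ (q u l₂)` is in `E`
    (∃ c : ℕ → F,
      (∀ u, algebraMap F E (c u) = (α : E) ^ (u * l₂) + (α : E) ^ (q * u * l₂)) ∧
      (X ^ n - 1 : F[X]) =
        (∏ t ∈ m.divisors.filter (fun t => Odd t), ∏ w ∈ binomialIndices q n t,
          (X ^ t - C ((θ : F) ^ (w * l₁)))) *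
        (∏ t ∈ m.divisors, ∏ u ∈ trinomialIndices q n r t,
          (X ^ (2 * t) - C (c u) * X ^ t + C ((θ : F) ^ (u * l₂)))) ∧
      (∀ t ∈ m.divisors, Odd t → ∀ w ∈ binomialIndices q n t,
        Irreducible (X ^ t - C ((θ : F) ^ (w * l₁)))) ∧
      (∀ t ∈ m.divisors, ∀ u ∈ trinomialIndices q n r t,
        Irreducible (X ^ (2 * t) - C (c u) * X ^ t + C ((θ : F) ^ (u * l₂))))) ∧
    -- (b) the number of binomials of degree `t` and `2t`, for odd `t`
    (∀ t ∈ m.divisors, Odd t →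
      (({g ∈ monicIrreducibleFactors (X ^ n - 1 : F[X]) |
          IsBinomial g ∧ g.natDegree = t}.ncard : ℚ) =
        (Nat.totient t : ℚ) / t * Nat.gcd n (q - 1)) ∧
      (({g ∈ monicIrreducibleFactors (X ^ n - 1 : F[X]) |
          IsBinomial g ∧ g.natDegree = 2 * t}.ncard : ℚ) =
        (Nat.totient t : ℚ) / (2 * t) * Nat.gcd n (q - 1))) ∧
    -- the number of trinomials of degree `2t`
    (∀ t ∈ m.divisors,
      ({g ∈ monicIrreducibleFactors (X ^ n - 1 : F[X]) |
          IsTrinomial g ∧ g.natDegree = 2 * t}.ncard : ℚ) =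
        if Even t then (Nat.totient t : ℚ) / t * (2 : ℚ) ^ ((r : ℤ) - 1) * Nat.gcd n (q - 1)
        else (Nat.totient t : ℚ) / t * ((2 : ℚ) ^ ((r : ℤ) - 1) - 1) * Nat.gcd n (q - 1)) ∧
    -- the total number of irreducible factors
    (((monicIrreducibleFactors (X ^ n - 1 : F[X])).ncard : ℚ) =
      (Nat.gcd n (q - 1) : ℚ) *
        (1 / 2 + (2 : ℚ) ^ ((r : ℤ) - 2) * (2 + (padicValNat 2 m : ℚ))) *
        ∏ p ∈ m.primeFactors.filter (fun p => Odd p),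
          (1 + (padicValNat p m : ℚ) * (((p : ℚ) - 1) / p))) := by
  classical
  have hq4 : q % 4 = 3 := hq
  have hpn := prime_dvd_sub_one_of_radical_dvd hn.ne' hrad
  have hr2 : 2 ≤ r := hr ▸ two_le_min_padicValNat hn hq h8
  have hd : Nat.gcd n (q ^ 2 - 1) = 2 ^ r * Nat.gcd n (q - 1) :=
    hr ▸ gcd_sq_sub_one hn hq h8 hpn
  have hmd : n = m * Nat.gcd n (q ^ 2 - 1) := by
    rw [hm, Nat.div_mul_cancel (Nat.gcd_dvd_left _ _)]
  have hql₁ : q - 1 = Nat.gcd n (q - 1) * l₁ := by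
    rw [hl₁, Nat.gcd_comm (q - 1), Nat.mul_div_cancel' (Nat.gcd_dvd_right _ _)]
  have hql₂ : q ^ 2 - 1 = Nat.gcd n (q ^ 2 - 1) * l₂ := by
    rw [hl₂, Nat.gcd_comm (q ^ 2 - 1), Nat.mul_div_cancel' (Nat.gcd_dvd_right _ _)]
  have hsq : q ^ 2 - 1 = (q + 1) * (q - 1) := by simpa using Nat.sq_sub_sq q 1
  have hu := gcd_sub_one_dvd_mul_iff hn hq h8 hd
  have hd₁ : 0 < Nat.gcd n (q - 1) := Nat.gcd_pos_of_pos_left _ hn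
  have hd₂ : 0 < Nat.gcd n (q ^ 2 - 1) := Nat.gcd_pos_of_pos_left _ hn
  have hq1 : 0 < q - 1 := by omega
  have hq21 : 0 < q ^ 2 - 1 := hsq ▸ Nat.mul_pos (by omega) hq1
  have hl₁0 : l₁ ≠ 0 := fun h => by rw [h, mul_zero] at hql₁; omega
  have hl₂0 : l₂ ≠ 0 := fun h => by rw [h, mul_zero] at hql₂; omega
  have hcardF : Nat.card Fˣ = Nat.gcd n (q - 1) * l₁ := by rw [Nat.card_units, hF, hql₁.symm]
  have hcardE : Nat.card Eˣ = Nat.gcd n (q ^ 2 - 1) * l₂ := by rw [Nat.card_units, hE, hql₂.symm]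
  have hθeq := generator_pow_mul_eq_iff hθ hl₁0 hcardF
  have hαeq := generator_pow_mul_eq_iff hα hl₂0 hcardE
  have hmn : ∀ t ∈ m.divisors, t ∣ n := fun t ht =>
    (Nat.dvd_of_mem_divisors ht).trans ⟨_, hmd⟩
  have ht0 : ∀ t ∈ m.divisors, t ≠ 0 := fun t ht => (Nat.pos_of_mem_divisors ht).ne'
  -- `m` and `l₂` are the cofactors of the same gcd in `n` and `q ^ 2 - 1`, hence coprime.
  have hpl₂ : ∀ t ∈ m.divisors, ∀ p : ℕ, p.Prime → p ∣ t → ¬ p ∣ l₂ := by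
    intro t ht p hp hpt hpl
    have hcop : Nat.Coprime m l₂ := by
      rw [hm, hl₂, Nat.gcd_comm (q ^ 2 - 1)]
      exact Nat.coprime_div_gcd_div_gcd hd₂
    exact hp.one_lt.ne' (Nat.dvd_one.1 (hcop ▸
      Nat.dvd_gcd (hpt.trans (Nat.dvd_of_mem_divisors ht)) hpl))
  -- Through this relation an odd prime dividing `l₁` also divides `l₂`.
  have hl₁₂ : 2 ^ r * l₂ = (q + 1) * l₁ := by
    refine Nat.eq_of_mul_eq_mul_left hd₁ ?_
    rw [← mul_assoc, mul_comm _ (2 ^ r), ← hd, ← hql₂, hsq]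
    conv_lhs => rw [hql₁]
    ring
  have hpl₁ : ∀ t ∈ m.divisors, Odd t → ∀ p : ℕ, p.Prime → p ∣ t → ¬ p ∣ l₁ := by
    intro t ht hto p hp hpt hpl
    rcases hp.dvd_mul.1 (hl₁₂ ▸ hpl.mul_left (q + 1) : p ∣ 2 ^ r * l₂) with h | h
    · have := (Nat.prime_dvd_prime_iff_eq hp Nat.prime_two).1 (hp.dvd_of_dvd_pow h)
      exact hto.not_two_dvd_nat (this ▸ hpt)
    · exact hpl₂ t ht p hp hpt h
  have hpgcd : ∀ {p u t : ℕ}, p.Prime → p ∣ t → Nat.gcd u t = 1 → ¬ p ∣ u :=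
    fun hp hpt hut hpu => hp.one_lt.ne' (Nat.dvd_one.1 (hut ▸ Nat.dvd_gcd hpu hpt))
  have hneg : IsSquare (-1 : E) := by
    have := Fintype.ofFinite E
    rw [FiniteField.isSquare_neg_one_iff, ← Nat.card_eq_fintype_card, hE, Nat.pow_mod, hq4]
    decide
  -- the indices
  have hRmem : ∀ t, ∀ u ∈ trinomialIndices q n r t,
      1 ≤ u ∧ u < Nat.gcd n (q ^ 2 - 1) ∧ Nat.gcd u t = 1 ∧ ¬ 2 ^ r ∣ u ∧
        u < (q * u) % Nat.gcd n (q ^ 2 - 1) := by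
    intro t u hut
    simp only [trinomialIndices, Finset.mem_filter, Finset.mem_Icc] at hut
    exact ⟨hut.1.1, hut.2.2.2.trans (Nat.mod_lt _ hd₂), hut.2⟩
  have hBmem : ∀ t, ∀ w ∈ binomialIndices q n t,
      1 ≤ w ∧ w ≤ Nat.gcd n (q - 1) ∧ Nat.gcd w t = 1 := by
    intro t w hwt
    simp only [binomialIndices, Finset.mem_filter, Finset.mem_Icc] at hwt
    exact ⟨hwt.1.1, hwt.1.2, hwt.2⟩
  have hpow : ∀ u, ((α : E) ^ (u * l₂)) ^ q = (α : E) ^ (q * u * l₂) := fun u => by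
    rw [← pow_mul]
    ring_nf
  obtain ⟨c, hc⟩ : ∃ c : ℕ → F, ∀ u,
      algebraMap F E (c u) = (α : E) ^ (u * l₂) + (α : E) ^ (q * u * l₂) :=
    ⟨fun u => Algebra.trace F E ((α : E) ^ (u * l₂)), fun u => by
      rw [algebraMap_trace_of_card_eq_sq (by rw [hE, hF]), hF, hpow]⟩
  have hN : ∀ u, algebraMap F E ((θ : F) ^ (u * l₂)) =
      (α : E) ^ (u * l₂) * (α : E) ^ (q * u * l₂) := fun u => by
    rw [map_pow, ← hαθ, ← pow_mul, ← pow_add]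
    ring_nf
  have hne : ∀ t, ∀ u ∈ trinomialIndices q n r t,
      (α : E) ^ (u * l₂) ≠ (α : E) ^ (q * u * l₂) := by
    intro t u hut h
    obtain ⟨-, h1, -, -, h2⟩ := hRmem t u hut
    rw [hαeq, Nat.ModEq, Nat.mod_eq_of_lt h1] at h
    omega
  have hc0 : ∀ t, ∀ u ∈ trinomialIndices q n r t, (c u = 0 ↔ 2 ^ (r - 1) ∣ u) := by
    intro t u hut
    rw [← (algebraMap F E).injective.eq_iff, hc, map_zero]
    -- As `β ≠ β ^ q`, `β + β ^ q = 0` means that `β` and `β ^ q` have equal squares, which is the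
    -- fixed-point condition for `2 * u`.
    have h1 : (α : E) ^ (u * l₂) + (α : E) ^ (q * u * l₂) = 0 ↔
        (α : E) ^ (2 * u * l₂) = (α : E) ^ (q * (2 * u) * l₂) := by
      have e1 : (α : E) ^ (2 * u * l₂) = ((α : E) ^ (u * l₂)) ^ 2 := by
        rw [← pow_mul]; ring_nf
      have e2 : (α : E) ^ (q * (2 * u) * l₂) = ((α : E) ^ (q * u * l₂)) ^ 2 := by
        rw [← pow_mul]; ring_nf
      rw [e1, e2, sq_eq_sq_iff_eq_or_eq_neg, or_iff_right (hne t u hut), add_eq_zero_iff_eq_neg]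
    rw [h1, hαeq, Nat.modEq_iff_dvd' (Nat.le_mul_of_pos_left _ (by omega)),
      show q * (2 * u) - 2 * u = (q - 1) * (2 * u) by rw [Nat.sub_mul, one_mul], hu,
      show r = r - 1 + 1 by omega, pow_succ', Nat.mul_dvd_mul_iff_left two_pos, Nat.add_sub_cancel]
  -- irreducibility
  have hfi : ∀ t ∈ m.divisors, Odd t → ∀ w ∈ binomialIndices q n t,
      Irreducible (X ^ t - C ((θ : F) ^ (w * l₁))) := by
    intro t ht hto w hw
    refine X_pow_sub_C_irreducible_of_odd hto fun p hp hpt => pow_ne_generator_pow hθ ?_ ?_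
    · rw [hcardF, ← hql₁]
      exact hpn p hp (hpt.trans (hmn t ht))
    · rw [hp.dvd_mul]
      exact not_or.2 ⟨hpgcd hp hpt (hBmem t w hw).2.2, hpl₁ t ht hto p hp hpt⟩
  have hgi : ∀ t ∈ m.divisors, ∀ u ∈ trinomialIndices q n r t,
      Irreducible (X ^ (2 * t) - C (c u) * X ^ t + C ((θ : F) ^ (u * l₂))) := by
    intro t ht u hut
    refine irreducible_trinomial (β := (α : E) ^ (u * l₂)) (by rw [hF, hpow, hc])
      (by rw [hF, hpow, hN]) (by rw [hF, hpow]; exact hne t u hut) ?_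
    refine X_pow_sub_C_irreducible_of_isSquare_neg_one (ht0 t ht) (fun _ => hneg)
      fun p hp hpt => pow_ne_generator_pow hα ?_ ?_
    · rw [hcardE, ← hql₂, hsq]
      exact (hpn p hp (hpt.trans (hmn t ht))).mul_left _
    · rw [hp.dvd_mul]
      exact not_or.2 ⟨hpgcd hp hpt (hRmem t u hut).2.2.1, hpl₂ t ht p hp hpt⟩
  -- divisibility
  have hfd : ∀ t ∈ m.divisors.filter (fun t => Odd t), ∀ w ∈ binomialIndices q n t,
      (X ^ t - C ((θ : F) ^ (w * l₁)) : F[X]) ∣ X ^ n - 1 := by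
    intro t ht w hw
    obtain ⟨k, hk⟩ := Nat.dvd_of_mem_divisors (Finset.mem_filter.1 ht).1
    have hn' : n = t * (k * Nat.gcd n (q ^ 2 - 1)) := by rw [← mul_assoc, ← hk, ← hmd]
    rw [hn']
    refine X_pow_sub_C_dvd_X_pow_sub_one ?_
    rw [← pow_mul, mul_right_comm, ← pow_zero (θ : F), ← zero_mul l₁, hθeq, Nat.modEq_zero_iff_dvd,
      hd]
    exact ((dvd_mul_left _ _).mul_left _).mul_left _
  have hgd : ∀ t ∈ m.divisors, ∀ u ∈ trinomialIndices q n r t,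
      (X ^ (2 * t) - C (c u) * X ^ t + C ((θ : F) ^ (u * l₂)) : F[X]) ∣ X ^ n - 1 := by
    intro t ht u hut
    obtain ⟨k, hk⟩ := Nat.dvd_of_mem_divisors ht
    have hn' : n = t * (k * Nat.gcd n (q ^ 2 - 1)) := by rw [← mul_assoc, ← hk, ← hmd]
    have hone : ∀ v, ((α : E) ^ (v * l₂)) ^ (k * Nat.gcd n (q ^ 2 - 1)) = 1 := fun v => by
      rw [← pow_mul, mul_right_comm, ← pow_zero (α : E), ← zero_mul l₂, hαeq,
        Nat.modEq_zero_iff_dvd]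
      exact (dvd_mul_left _ _).mul_left _
    have := trinomial_dvd_X_pow_sub_one (t := t) (hc u) (hN u) (hne t u hut) (hone u) (hone _)
    rwa [← hn'] at this
  -- distinctness
  have hff : ∀ t ∈ m.divisors.filter (fun t => Odd t), ∀ w ∈ binomialIndices q n t,
      ∀ t' ∈ m.divisors.filter (fun t => Odd t), ∀ w' ∈ binomialIndices q n t',
      (X ^ t - C ((θ : F) ^ (w * l₁)) : F[X]) = X ^ t' - C ((θ : F) ^ (w' * l₁)) →
      t = t' ∧ w = w' := by
    intro t _ w hw t' _ w' hw' h
    obtain ⟨h1, h2⟩ := X_pow_sub_C_inj h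
    obtain ⟨a1, a2, -⟩ := hBmem t w hw
    obtain ⟨b1, b2, -⟩ := hBmem t' w' hw'
    refine ⟨h1, ?_⟩
    rw [hθeq] at h2
    -- The shift moves the range `1, …, g` to the residues `0, …, g - 1`.
    have h3 : w - 1 ≡ w' - 1 [MOD Nat.gcd n (q - 1)] := by
      refine Nat.ModEq.add_right_cancel' 1 ?_
      rwa [Nat.sub_add_cancel a1, Nat.sub_add_cancel b1]
    have := h3.eq_of_lt_of_lt (by omega) (by omega)
    omega
  have hgg : ∀ t ∈ m.divisors, ∀ u ∈ trinomialIndices q n r t,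
      ∀ t' ∈ m.divisors, ∀ u' ∈ trinomialIndices q n r t',
      (X ^ (2 * t) - C (c u) * X ^ t + C ((θ : F) ^ (u * l₂)) : F[X]) =
        X ^ (2 * t') - C (c u') * X ^ t' + C ((θ : F) ^ (u' * l₂)) →
      t = t' ∧ u = u' := by
    intro t ht u hut t' _ u' hut' h
    obtain ⟨h1, h2, h3⟩ := X_pow_sub_C_mul_X_pow_add_C_inj (ht0 t ht) h
    refine ⟨h1, ?_⟩
    have e2 := congrArg (algebraMap F E) h2
    have e3 := congrArg (algebraMap F E) h3
    rw [hc, hc] at e2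
    rw [hN, hN] at e3
    obtain ⟨-, a1, -, -, a2⟩ := hRmem t u hut
    obtain ⟨-, b1, -, -, b2⟩ := hRmem t' u' hut'
    rcases eq_or_eq_of_add_eq_of_mul_eq e2 e3 with h | h
    · exact ((hαeq _ _).1 h).eq_of_lt_of_lt a1 b1
    -- Here `u` and `u'` are exchanged by the involution, so each would be smaller than the other.
    · have h4 := (hαeq _ _).1 h
      have h5 : (α : E) ^ (q * u * l₂) = (α : E) ^ (u' * l₂) := by
        rw [h, add_comm] at e2
        exact add_right_cancel e2
      rw [hαeq] at h5
      rw [Nat.ModEq, Nat.mod_eq_of_lt a1] at h4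
      rw [Nat.ModEq, Nat.mod_eq_of_lt b1] at h5
      omega
  have hfg : ∀ t ∈ m.divisors.filter (fun t => Odd t), ∀ w ∈ binomialIndices q n t,
      ∀ t' ∈ m.divisors, ∀ u ∈ trinomialIndices q n r t',
      (X ^ t - C ((θ : F) ^ (w * l₁)) : F[X]) ≠
        X ^ (2 * t') - C (c u) * X ^ t' + C ((θ : F) ^ (u * l₂)) := by
    intro t ht w _ t' _ u _ h
    have h1 := congrArg natDegree h
    rw [natDegree_X_pow_sub_C, natDegree_X_pow_sub_C_mul_X_pow_add_C] at h1
    have := Nat.odd_iff.1 (Finset.mem_filter.1 ht).2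
    omega
  obtain ⟨hprod, hcount⟩ := eq_prod_mul_prod_and_ncard (P := (X ^ n - 1 : F[X]))
    (by simpa using monic_X_pow_sub_C (1 : F) hn.ne')
    (fun t ht w _ => monic_X_pow_sub_C _ (ht0 t (Finset.mem_filter.1 ht).1))
    (fun t ht u _ => monic_X_pow_sub_C_mul_X_pow_add_C (ht0 t ht) (c u) ((θ : F) ^ (u * l₂)))
    (fun t ht => hfi t (Finset.mem_filter.1 ht).1 (Finset.mem_filter.1 ht).2)
    hgi hfd hgd hff hgg hfg (by
      simp only [natDegree_X_pow_sub_C, natDegree_X_pow_sub_C_mul_X_pow_add_C, Finset.sum_const,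
        smul_eq_mul]
      rw [sum_card_mul_natDegree hn hq h8 hpn hd hr2 hmd]
      simpa using (natDegree_X_pow_sub_C (n := n) (r := (1 : F))).symm)
  have hθ0 : ∀ k, (θ : F) ^ k ≠ 0 := fun k => pow_ne_zero k θ.ne_zero
  -- counting by number of terms and degree
  have hcountf : ∀ k d : ℕ,
      {g ∈ monicIrreducibleFactors (X ^ n - 1 : F[X]) | g.support.card = k ∧ g.natDegree = d}.ncard =
        ∑ t ∈ m.divisors.filter (fun t => Odd t),
          (if k = 2 ∧ t = d then (binomialIndices q n t).card else 0) +
        ∑ t ∈ m.divisors, if 2 * t = d then ((trinomialIndices q n r t).filter fun u =>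
          (if 2 ^ (r - 1) ∣ u then 2 else 3) = k).card else 0 := by
    intro k d
    rw [hcount (fun g => g.support.card = k ∧ g.natDegree = d)]
    congr 1
    · refine Finset.sum_congr rfl fun t ht => ?_
      simp only [card_support_X_pow_sub_C (ht0 t (Finset.mem_filter.1 ht).1) (hθ0 _),
        natDegree_X_pow_sub_C, eq_comm (a := 2) (b := k)]
      split_ifs with h <;> simp [h]
    · refine Finset.sum_congr rfl fun t ht => ?_
      simp only [card_support_X_pow_sub_C_mul_X_pow_add_C (ht0 t ht) (hθ0 _),
        natDegree_X_pow_sub_C_mul_X_pow_add_C]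
      split_ifs with h
      · simp only [h, and_true]
        congr 1
        exact Finset.filter_congr fun u hut => by simp only [hc0 t u hut]
      · simp [h]
  have hcast : ∀ {t : ℕ}, t ∈ m.divisors → (t : ℚ) ≠ 0 := fun ht =>
    Nat.cast_ne_zero.2 (ht0 _ ht)
  have hz : (2 : ℚ) ^ ((r : ℤ) - 1) = 2 ^ r / 2 := by
    rw [zpow_sub₀ two_ne_zero, zpow_natCast, zpow_one]
  refine ⟨⟨c, hc, hprod, hfi, hgi⟩, fun t ht hto => ⟨?_, ?_⟩, fun t ht => ?_, ?_⟩
  · have h1 := hcountf 2 t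
    rw [Finset.sum_eq_single t, Finset.sum_eq_zero, add_zero, if_pos ⟨rfl, rfl⟩] at h1
    · have h2 := mul_card_binomialIndices hpn (hmn t ht)
      have h3 := hcast ht
      apply_fun ((↑) : ℕ → ℚ) at h2
      push_cast at h2
      unfold IsBinomial
      rw [h1]
      field_simp
      linear_combination h2
    · intro s _
      rw [if_neg]
      rintro rfl
      exact absurd hto (by simp)
    · intro s _ hs
      rw [if_neg (fun h => hs h.2)]
    · intro h
      exact absurd (Finset.mem_filter.2 ⟨ht, hto⟩) h
  · have h1 := hcountf 2 (2 * t)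
    rw [Finset.sum_eq_zero, zero_add, Finset.sum_eq_single t, if_pos rfl] at h1
    · have h2 := two_mul_card_filter_trinomialIndices_of_odd hn hq h8 hpn hd (hmn t ht) hto
        (Nat.sub_le r 1)
      rw [show r - (r - 1) = 1 by omega] at h2
      have h3 := hcast ht
      have h4 : ((trinomialIndices q n r t).filter fun u =>
          (if 2 ^ (r - 1) ∣ u then 2 else 3) = 2) =
          (trinomialIndices q n r t).filter fun u => 2 ^ (r - 1) ∣ u :=
        Finset.filter_congr fun u _ => by split_ifs with h <;> simp [h]
      apply_fun ((↑) : ℕ → ℚ) at h2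
      push_cast at h2
      unfold IsBinomial
      rw [h1, h4]
      field_simp
      linear_combination h2
    · intro s _ hs
      rw [if_neg (by omega)]
    · exact fun h => absurd ht h
    · intro s hs
      have := Nat.odd_iff.1 (Finset.mem_filter.1 hs).2
      rw [if_neg (by omega)]
  · have h1 := hcountf 3 (2 * t)
    have h4 : ((trinomialIndices q n r t).filter fun u =>
        (if 2 ^ (r - 1) ∣ u then 2 else 3) = 3) =
        (trinomialIndices q n r t).filter fun u => ¬ 2 ^ (r - 1) ∣ u :=
      Finset.filter_congr fun u _ => by split_ifs with h <;> simp [h]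
    have h3 := hcast ht
    rw [Finset.sum_eq_zero (fun s _ => if_neg (by omega)), zero_add, Finset.sum_eq_single t
      (fun s _ hs => if_neg (by omega)) (fun h => absurd ht h), if_pos rfl, h4] at h1
    unfold IsTrinomial
    rw [h1, hz]
    split_ifs with hte
    · have h2 := two_mul_card_trinomialIndices_of_even hn hq h8 hpn hd hr2 (hmn t ht) hte
      rw [Finset.filter_true_of_mem]
      · apply_fun ((↑) : ℕ → ℚ) at h2
        push_cast at h2
        field_simp
        linear_combination h2
      -- For even `t` the index `u` is odd while `r - 1 ≥ 1`, so no middle coefficient vanishes.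
      · intro u hut h
        exact hpgcd Nat.prime_two hte.two_dvd (hRmem t u hut).2.2.1
          ((dvd_pow_self 2 (by omega)).trans h)
    · have hto := Nat.not_even_iff_odd.1 hte
      have h2 := two_mul_card_trinomialIndices_of_odd hn hq h8 hpn hd (hmn t ht) hto
      have h5 := two_mul_card_filter_trinomialIndices_of_odd hn hq h8 hpn hd (hmn t ht) hto
        (Nat.sub_le r 1)
      rw [show r - (r - 1) = 1 by omega] at h5
      -- For odd `t`, the trinomials are all indices minus those giving binomials of degree `2t`.
      rw [← Finset.card_filter_add_card_filter_not (s := trinomialIndices q n r t)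
        (fun u => 2 ^ (r - 1) ∣ u)] at h2
      apply_fun ((↑) : ℕ → ℚ) at h2 h5
      push_cast at h2 h5
      field_simp
      linear_combination h2 - h5
  · have h1 := hcount (fun _ => True)
    simp only [and_true, Finset.filter_true] at h1
    rw [← sum_card_indices hn hq h8 hpn hd hr2 hmd, ← h1]
    rfl
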